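/- Let $k$ and $m$ be positive integers with $k<m<2k$. For $n\ge 0$ let $\bar h(m,n)$ denote the number of tilings of an $m\times n\times k$ cuboid by $k\times k\times 1$ bricks; here the bricks may be used in any of their three axis-parallel orientations, a tiling is a set of non-overlapping bricks, placed along the unit cells of the cuboid, whose union is the cuboid, tilings that differ by a symmetry of the cuboid are counted as different, and $\bar h(m,0)=1$. Then, as formal power series in $x$, $$ \sum_{n\geq 0}\bar h(m,n)\,x^n = \frac{(1-2x^k)^{k-1}}{(1-2x^k)^{k-1}\bigl[1-(m-k+2)x^k\bigr]-(m-k+1)x^k}. $$ -/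

import Mathlib

/-- The integer box with least cell `p` and side lengths `s`, as a finite set of unit cells.
A unit cell of the positive octant is represented by its least corner. -/
def latticeBox (p s : ℕ × ℕ × ℕ) : Finset (ℕ × ℕ × ℕ) :=
  Finset.Ico p.1 (p.1 + s.1) ×ˢ
    (Finset.Ico p.2.1 (p.2.1 + s.2.1) ×ˢ Finset.Ico p.2.2 (p.2.2 + s.2.2))

/-- The `a × b × c` cuboid with a corner at the origin. -/
def cuboid (a b c : ℕ) : Finset (ℕ × ℕ × ℕ) := latticeBox (0, 0, 0) (a, b, c)

/-- `B` is a `k × k × 1` brick, in any position and in any of its three orientations. -/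
def IsBrick (k : ℕ) (B : Finset (ℕ × ℕ × ℕ)) : Prop :=
  ∃ p : ℕ × ℕ × ℕ,
    B = latticeBox p (k, k, 1) ∨ B = latticeBox p (k, 1, k) ∨ B = latticeBox p (1, k, k)

/-- `T` is a tiling of the `m × n × k` cuboid by `k × k × 1` bricks: a set of bricks that are
pairwise disjoint and whose union is the cuboid. -/
def IsBrickTiling (k m n : ℕ) (T : Finset (Finset (ℕ × ℕ × ℕ))) : Prop :=
  (∀ B ∈ T, IsBrick k B) ∧
    (T : Set (Finset (ℕ × ℕ × ℕ))).PairwiseDisjoint id ∧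
    T.biUnion id = cuboid m n k

/-- There are only finitely many tilings, so that counting them by `Set.ncard` is meaningful. -/
theorem finite_setOf_isBrickTiling (k m n : ℕ) :
    {T : Finset (Finset (ℕ × ℕ × ℕ)) | IsBrickTiling k m n T}.Finite := by
  refine ((cuboid m n k).powerset.powerset.finite_toSet).subset ?_
  intro T hT
  rw [Finset.mem_coe, Finset.mem_powerset]
  intro B hB
  rw [Finset.mem_powerset, ← hT.2.2]
  exact Finset.subset_biUnion_of_mem id hB

/-- The number of tilings of the `m × n × k` cuboid by `k × k × 1` bricks. -/
noncomputable def numBrickTilings (k m n : ℕ) : ℕ :=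
  {T : Finset (Finset (ℕ × ℕ × ℕ)) | IsBrickTiling k m n T}.ncard

/-! In height `k` a brick is horizontal, or stands across `k` columns, or stands along a single one
(a column being the cells with one value of `x`). As `m < 2 * k`, any `k` adjacent columns include
column `k - 1`, so the brick at the far end of that column decides the end of the tiling: either all
bricks there run along, or at one of d = m - k + 1 positions `a` there is a packet of `k` horizontal
bricks or one brick across, and the other columns are forced to end in bricks along.

A brick across leaves the columns over `[a, a + k)` longer than the others by `k - 1`. With H the
wanted series and F_j the series for a step of length j at `a`, `card_tilings_cuboid` gives H = 1 +
x^k (H + d H + Σ_a F_{k-1}).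

The protruding block ends in one brick across, which shortens the step by 1, or in `k` parallel
bricks, along or horizontal. Removing these `k` makes the outer columns protrude; their ends are
forced, and the same step returns with all lengths smaller by `k`. Hence (1 - 2x^k) F_j = F_{j-1}
for 0 < j < k, with F_0 = H, and eliminating F_{k-1} gives the formula. -/

/-- `T` is a tiling of the set of cells `R` by `k × k × 1` bricks. -/
def IsTilingOf (k : ℕ) (R : Finset (ℕ × ℕ × ℕ)) (T : Finset (Finset (ℕ × ℕ × ℕ))) : Prop :=
  (∀ B ∈ T, IsBrick k B) ∧
    (T : Set (Finset (ℕ × ℕ × ℕ))).PairwiseDisjoint id ∧ T.biUnion id = R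

open Classical in
/-- The finite set of all tilings of `R`. -/
noncomputable def tilings (k : ℕ) (R : Finset (ℕ × ℕ × ℕ)) :
    Finset (Finset (Finset (ℕ × ℕ × ℕ))) :=
  R.powerset.powerset.filter (IsTilingOf k R)

theorem mem_tilings {k : ℕ} {R : Finset (ℕ × ℕ × ℕ)} {T : Finset (Finset (ℕ × ℕ × ℕ))} :
    T ∈ tilings k R ↔ IsTilingOf k R T := by
  classical
  rw [tilings, Finset.mem_filter, and_iff_right_iff_imp]
  intro hT
  rw [Finset.mem_powerset]
  intro B hB
  rw [Finset.mem_powerset, ← hT.2.2]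
  exact Finset.subset_biUnion_of_mem id hB

theorem numBrickTilings_eq_card (k m n : ℕ) :
    numBrickTilings k m n = (tilings k (cuboid m n k)).card := by
  rw [numBrickTilings, ← Set.ncard_coe_finset]
  congr 1
  ext T
  rw [Finset.mem_coe, mem_tilings]
  rfl

theorem mem_latticeBox {x y z a b c u v w : ℕ} :
    (x, y, z) ∈ latticeBox (a, b, c) (u, v, w) ↔
      (a ≤ x ∧ x < a + u) ∧ (b ≤ y ∧ y < b + v) ∧ c ≤ z ∧ z < c + w := by
  simp [latticeBox]

/-! ### Bricks of a tiling that share a cell -/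

namespace IsTilingOf

variable {k : ℕ} {R : Finset (ℕ × ℕ × ℕ)} {T : Finset (Finset (ℕ × ℕ × ℕ))}

theorem subset (hT : IsTilingOf k R T) {B : Finset (ℕ × ℕ × ℕ)} (hB : B ∈ T) : B ⊆ R := by
  rw [← hT.2.2]
  exact Finset.subset_biUnion_of_mem id hB

theorem eq_of_mem (hT : IsTilingOf k R T) {B C : Finset (ℕ × ℕ × ℕ)} (hB : B ∈ T) (hC : C ∈ T)
    {c : ℕ × ℕ × ℕ} (hcB : c ∈ B) (hcC : c ∈ C) : B = C := by
  by_contra h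
  exact Finset.disjoint_left.1 (hT.2.1 hB hC h) hcB hcC

theorem box_injective (hT : IsTilingOf k R T) {a b c u v w a' b' c' u' v' w' : ℕ}
    (hB : latticeBox (a, b, c) (u, v, w) ∈ T) (hC : latticeBox (a', b', c') (u', v', w') ∈ T)
    (x y z : ℕ)
    (h : (a ≤ x ∧ x < a + u) ∧ (b ≤ y ∧ y < b + v) ∧ c ≤ z ∧ z < c + w)
    (h' : (a' ≤ x ∧ x < a' + u') ∧ (b' ≤ y ∧ y < b' + v') ∧ c' ≤ z ∧ z < c' + w') :
    (a = a' ∧ u = u') ∧ (b = b' ∧ v = v') ∧ c = c' ∧ w = w' := by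
  have e := hT.eq_of_mem hB hC (mem_latticeBox.2 h) (mem_latticeBox.2 h')
  have key : ∀ x y z, ((a ≤ x ∧ x < a + u) ∧ (b ≤ y ∧ y < b + v) ∧ c ≤ z ∧ z < c + w) ↔
      ((a' ≤ x ∧ x < a' + u') ∧ (b' ≤ y ∧ y < b' + v') ∧ c' ≤ z ∧ z < c' + w') := fun x y z => by
    rw [← mem_latticeBox, ← mem_latticeBox, e]
  -- Opposite corners of each box lie in the other, which forces equal corners and sides.
  have h1 := (key a b c).1 (by omega)
  have h2 := (key (a + u - 1) (b + v - 1) (c + w - 1)).1 (by omega)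
  have h3 := (key a' b' c').2 (by omega)
  have h4 := (key (a' + u' - 1) (b' + v' - 1) (c' + w' - 1)).2 (by omega)
  omega

theorem box_subset (hT : IsTilingOf k R T) {a b c u v w : ℕ}
    (hB : latticeBox (a, b, c) (u, v, w) ∈ T) (x y z : ℕ)
    (h : (a ≤ x ∧ x < a + u) ∧ (b ≤ y ∧ y < b + v) ∧ c ≤ z ∧ z < c + w) : (x, y, z) ∈ R :=
  hT.subset hB (mem_latticeBox.2 h)

/-- In a region of height `k`, the brick that covers a given cell is horizontal, or it is one of
the two kinds of vertical bricks, which then span the whole height. -/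
theorem exists_brick (hk : 0 < k) (hT : IsTilingOf k R T)
    (hR : ∀ x y z, (x, y, z) ∈ R → z < k) {x y z : ℕ} (hc : (x, y, z) ∈ R) :
    (∃ x₀ y₀, latticeBox (x₀, y₀, z) (k, k, 1) ∈ T ∧
        (x₀ ≤ x ∧ x < x₀ + k) ∧ (y₀ ≤ y ∧ y < y₀ + k)) ∨
      (∃ x₀, latticeBox (x₀, y, 0) (k, 1, k) ∈ T ∧ x₀ ≤ x ∧ x < x₀ + k) ∨
      ∃ y₀, latticeBox (x, y₀, 0) (1, k, k) ∈ T ∧ y₀ ≤ y ∧ y < y₀ + k := by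
  have hc' := hc
  rw [← hT.2.2, Finset.mem_biUnion] at hc'
  obtain ⟨B, hB, hcB⟩ := hc'
  obtain ⟨⟨a, b, c⟩, rfl | rfl | rfl⟩ := hT.1 B hB <;> rw [id, mem_latticeBox] at hcB
  · obtain rfl : c = z := by omega
    exact Or.inl ⟨a, b, hB, by omega⟩
  · obtain rfl : b = y := by omega
    have := hR _ _ _ (hT.subset hB (mem_latticeBox.2
      (⟨⟨le_rfl, by omega⟩, ⟨le_rfl, by omega⟩, by omega, by omega⟩ :
        (a ≤ a ∧ a < a + k) ∧ (b ≤ b ∧ b < b + 1) ∧ c ≤ c + k - 1 ∧ c + k - 1 < c + k)))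
    obtain rfl : c = 0 := by omega
    exact Or.inr (Or.inl ⟨a, hB, by omega⟩)
  · obtain rfl : a = x := by omega
    have := hR _ _ _ (hT.subset hB (mem_latticeBox.2
      (⟨⟨le_rfl, by omega⟩, ⟨le_rfl, by omega⟩, by omega, by omega⟩ :
        (a ≤ a ∧ a < a + 1) ∧ (b ≤ b ∧ b < b + k) ∧ c ≤ c + k - 1 ∧ c + k - 1 < c + k)))
    obtain rfl : c = 0 := by omega
    exact Or.inr (Or.inr ⟨b, hB, by omega⟩)

end IsTilingOf

/-! ### Counting by forced configurations -/

theorem IsBrick.nonempty {k : ℕ} (hk : 0 < k) {B : Finset (ℕ × ℕ × ℕ)} (hB : IsBrick k B) :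
    B.Nonempty := by
  obtain ⟨⟨a, b, c⟩, rfl | rfl | rfl⟩ := hB <;>
    exact ⟨(a, b, c), mem_latticeBox.2 (by omega)⟩

/-- The tilings that contain a given set of bricks correspond to the tilings of the rest. -/
theorem card_tilings_containing {k : ℕ} (hk : 0 < k) {R R' : Finset (ℕ × ℕ × ℕ)}
    {P : Finset (Finset (ℕ × ℕ × ℕ))} (hP : ∀ B ∈ P, IsBrick k B)
    (hd : (P : Set (Finset (ℕ × ℕ × ℕ))).PairwiseDisjoint id)
    (hR : ∀ c, c ∈ R ↔ c ∈ R' ∨ ∃ B ∈ P, c ∈ B) (hR' : ∀ B ∈ P, ∀ c ∈ B, c ∉ R') :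
    ((tilings k R).filter (fun T => P ⊆ T)).card = (tilings k R').card := by
  classical
  refine Finset.card_nbij' (fun T => T \ P) (fun T => T ∪ P) ?_ ?_ ?_ ?_
  · intro T hT
    rw [Finset.mem_coe, Finset.mem_filter, mem_tilings] at hT
    obtain ⟨hT, hPT⟩ := hT
    rw [Finset.mem_coe, mem_tilings]
    refine ⟨fun B hB => hT.1 B (Finset.sdiff_subset hB),
      hT.2.1.subset (Finset.coe_subset.2 Finset.sdiff_subset), ?_⟩
    ext c
    rw [Finset.mem_biUnion]
    constructor
    · rintro ⟨B, hB, hc⟩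
      rw [Finset.mem_sdiff] at hB
      refine ((hR c).1 (hT.subset hB.1 hc)).resolve_right ?_
      rintro ⟨C, hC, hcC⟩
      exact hB.2 (hT.eq_of_mem hB.1 (hPT hC) hc hcC ▸ hC)
    · intro hc
      have hcR := (hR c).2 (Or.inl hc)
      rw [← hT.2.2, Finset.mem_biUnion] at hcR
      obtain ⟨B, hB, hcB⟩ := hcR
      exact ⟨B, Finset.mem_sdiff.2 ⟨hB, fun h => hR' B h c hcB hc⟩, hcB⟩
  · intro T hT
    rw [Finset.mem_coe, mem_tilings] at hT
    rw [Finset.mem_coe, Finset.mem_filter, mem_tilings]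
    refine ⟨⟨fun B hB => (Finset.mem_union.1 hB).elim (hT.1 B) (hP B), ?_, ?_⟩,
      Finset.subset_union_right⟩
    · rw [Finset.coe_union, Set.pairwiseDisjoint_union]
      refine ⟨hT.2.1, hd, fun B hB C hC _ => ?_⟩
      exact Finset.disjoint_left.2 fun c hcB hcC => hR' C hC c hcC (hT.subset hB hcB)
    · ext c
      rw [hR, ← hT.2.2, Finset.union_biUnion, Finset.mem_union, Finset.mem_biUnion,
        Finset.mem_biUnion]
      rfl
  · intro T hT
    exact Finset.sdiff_union_of_subset (Finset.mem_filter.1 hT).2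
  · intro T hT
    rw [Finset.mem_coe, mem_tilings] at hT
    refine Finset.union_sdiff_cancel_right (Finset.disjoint_left.2 fun B hB hBP => ?_)
    obtain ⟨c, hc⟩ := (hT.1 B hB).nonempty hk
    exact hR' B hBP c hc (hT.subset hB hc)

/-- Classification of the tilings of `R` by the one of the configurations `P i` they contain. -/
theorem card_tilings_eq_sum {k : ℕ} {R : Finset (ℕ × ℕ × ℕ)} {ι : Type*} [Fintype ι]
    (P : ι → Finset (Finset (ℕ × ℕ × ℕ)))
    (hex : ∀ T, IsTilingOf k R T → ∃ i, P i ⊆ T)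
    (huniq : ∀ T, IsTilingOf k R T → ∀ i j, P i ⊆ T → P j ⊆ T → i = j) :
    (tilings k R).card = ∑ i, ((tilings k R).filter (fun T => P i ⊆ T)).card := by
  classical
  rw [← Finset.card_biUnion]
  · congr 1
    ext T
    simp only [Finset.mem_biUnion, Finset.mem_univ, true_and, Finset.mem_filter]
    exact ⟨fun h => (hex T (mem_tilings.1 h)).imp fun i hi => ⟨h, hi⟩, fun ⟨_, h, _⟩ => h⟩
  · intro i _ j _ hij
    refine Finset.disjoint_left.2 fun T hi hj => hij ?_
    rw [Finset.mem_filter] at hi hj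
    exact huniq T (mem_tilings.1 hi.1) i j hi.2 hj.2

/-! ### Stepped boxes -/

/-- The part of the `m × ∞ × k` cuboid whose columns over `[a, a + k)` have length `q` and whose
other columns have length `p`. -/
def steppedBox (k m a p q : ℕ) : Finset (ℕ × ℕ × ℕ) :=
  (cuboid m (p + q) k).filter fun c =>
    (a ≤ c.1 ∧ c.1 < a + k) ∧ c.2.1 < q ∨ ¬ (a ≤ c.1 ∧ c.1 < a + k) ∧ c.2.1 < p

theorem mem_steppedBox {k m a p q x y z : ℕ} :
    (x, y, z) ∈ steppedBox k m a p q ↔ x < m ∧ z < k ∧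
      ((a ≤ x ∧ x < a + k) ∧ y < q ∨ ¬ (a ≤ x ∧ x < a + k) ∧ y < p) := by
  rw [steppedBox, Finset.mem_filter, cuboid, mem_latticeBox]
  dsimp only
  omega

theorem mem_cuboid {m n k x y z : ℕ} : (x, y, z) ∈ cuboid m n k ↔ x < m ∧ y < n ∧ z < k := by
  rw [cuboid, mem_latticeBox]
  omega

theorem steppedBox_self (k m a n : ℕ) : steppedBox k m a n n = cuboid m n k := by
  ext ⟨x, y, z⟩
  rw [mem_steppedBox, mem_cuboid]
  omega

/-- Bricks `f i`, `i ∈ S`, that are pairwise disjoint. -/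
theorem pairwiseDisjoint_image {S : Finset ℕ} {f : ℕ → Finset (ℕ × ℕ × ℕ)}
    (h : ∀ i j x y z, (x, y, z) ∈ f i → (x, y, z) ∈ f j → i = j) :
    ((S.image f : Finset (Finset (ℕ × ℕ × ℕ))) : Set (Finset (ℕ × ℕ × ℕ))).PairwiseDisjoint
      id := by
  intro B hB C hC hBC
  rw [Finset.mem_coe, Finset.mem_image] at hB hC
  obtain ⟨i, -, rfl⟩ := hB
  obtain ⟨j, -, rfl⟩ := hC
  refine Finset.disjoint_left.2 ?_
  rintro ⟨x, y, z⟩ hx hy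
  exact hBC (by rw [h i j x y z hx hy])

theorem card_tilings_containing_image {k : ℕ} (hk : 0 < k) {R R' : Finset (ℕ × ℕ × ℕ)}
    {S : Finset ℕ} {f : ℕ → Finset (ℕ × ℕ × ℕ)} (hf : ∀ i, IsBrick k (f i))
    (hd : ∀ i j x y z, (x, y, z) ∈ f i → (x, y, z) ∈ f j → i = j)
    (hR : ∀ x y z, (x, y, z) ∈ R ↔ (x, y, z) ∈ R' ∨ ∃ i ∈ S, (x, y, z) ∈ f i)
    (hR' : ∀ i ∈ S, ∀ x y z, (x, y, z) ∈ f i → (x, y, z) ∉ R') :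
    ((tilings k R).filter (fun T => S.image f ⊆ T)).card = (tilings k R').card := by
  refine card_tilings_containing hk ?_ (pairwiseDisjoint_image hd) ?_ ?_
  · intro B hB
    obtain ⟨i, -, rfl⟩ := Finset.mem_image.1 hB
    exact hf i
  · rintro ⟨x, y, z⟩
    rw [hR, Finset.exists_mem_image]
  · intro B hB
    obtain ⟨i, hi, rfl⟩ := Finset.mem_image.1 hB
    rintro ⟨x, y, z⟩
    exact hR' i hi x y z

/-! ### Protruding outer columns are forced -/

section Outer

variable {k m a p q : ℕ}

theorem IsTilingOf.exists_brick_steppedBox (hk : 0 < k) {T : Finset (Finset (ℕ × ℕ × ℕ))}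
    (hT : IsTilingOf k (steppedBox k m a p q) T) {x y z : ℕ}
    (hc : (x, y, z) ∈ steppedBox k m a p q) :
    (∃ x₀ y₀, latticeBox (x₀, y₀, z) (k, k, 1) ∈ T ∧
        (x₀ ≤ x ∧ x < x₀ + k) ∧ (y₀ ≤ y ∧ y < y₀ + k)) ∨
      (∃ x₀, latticeBox (x₀, y, 0) (k, 1, k) ∈ T ∧ x₀ ≤ x ∧ x < x₀ + k) ∨
      ∃ y₀, latticeBox (x, y₀, 0) (1, k, k) ∈ T ∧ y₀ ≤ y ∧ y < y₀ + k :=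
  hT.exists_brick hk (fun _ _ _ h => (mem_steppedBox.1 h).2.1) hc

/-- The protruding ends of the outer columns can only be covered by bricks along the columns. -/
theorem IsTilingOf.outer_brick (ha : a + k ≤ m) (hm : m < 2 * k) (hqp : q < p)
    {T : Finset (Finset (ℕ × ℕ × ℕ))} (hT : IsTilingOf k (steppedBox k m a p q) T) {x : ℕ}
    (hx : x < m) (hxa : ¬ (a ≤ x ∧ x < a + k)) :
    k ≤ p ∧ latticeBox (x, p - k, 0) (1, k, k) ∈ T := by
  have hk : 0 < k := by omega
  obtain ⟨x₀, y₀, hB, h⟩ | ⟨x₀, hB, h⟩ | ⟨y₀, hB, h⟩ :=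
    hT.exists_brick_steppedBox hk (x := x) (y := p - 1) (z := 0)
      (mem_steppedBox.2 (by omega))
  · have h1 := mem_steppedBox.1 (hT.box_subset hB x₀ (p - 1) 0 (by omega))
    have h2 := mem_steppedBox.1 (hT.box_subset hB (x₀ + k - 1) (p - 1) 0 (by omega))
    -- Fewer than `k` columns lie on either side of `[a, a + k)`, so a brick of width `k` starting
    -- on the left reaches column `a`, which is too short, and one starting on the right leaves the
    -- box.
    by_cases h3 : x₀ ≤ a
    · have h4 := mem_steppedBox.1 (hT.box_subset hB a (p - 1) 0 (by omega))
      omega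
    · omega
  · have h1 := mem_steppedBox.1 (hT.box_subset hB x₀ (p - 1) 0 (by omega))
    have h2 := mem_steppedBox.1 (hT.box_subset hB (x₀ + k - 1) (p - 1) 0 (by omega))
    by_cases h3 : x₀ ≤ a
    · have h4 := mem_steppedBox.1 (hT.box_subset hB a (p - 1) 0 (by omega))
      omega
    · omega
  · have h1 := mem_steppedBox.1 (hT.box_subset hB x (y₀ + k - 1) 0 (by omega))
    have e : y₀ = p - k := by omega
    exact ⟨by omega, e ▸ hB⟩

theorem card_tilings_outer_of_lt (ha : a + k ≤ m) (hkm : k < m) (hm : m < 2 * k) (hqp : q < p)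
    (hpk : p < k) : (tilings k (steppedBox k m a p q)).card = 0 := by
  rw [Finset.card_eq_zero, Finset.eq_empty_iff_forall_notMem]
  intro T hT
  rw [mem_tilings] at hT
  -- An outer column exists because `k < m`: column `k` if `a = 0`, otherwise column `0`.
  by_cases h0 : a = 0
  · have := hT.outer_brick ha hm hqp (x := k) hkm (by omega)
    omega
  · have := hT.outer_brick ha hm hqp (x := 0) (by omega) (by omega)
    omega

theorem card_tilings_outer (ha : a + k ≤ m) (hm : m < 2 * k) (hqp : q < p + k) :
    (tilings k (steppedBox k m a (p + k) q)).card = (tilings k (steppedBox k m a p q)).card := by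
  have hk : 0 < k := by omega
  rw [card_tilings_eq_sum (ι := Unit) (fun _ =>
    ((Finset.range m).filter fun x => ¬ (a ≤ x ∧ x < a + k)).image
      fun x => latticeBox (x, p, 0) (1, k, k)), Fintype.sum_unique]
  · refine card_tilings_containing_image hk (fun i => ⟨_, Or.inr (Or.inr rfl)⟩) ?_ ?_ ?_
    · intro i j x y z
      rw [mem_latticeBox, mem_latticeBox]
      omega
    · intro x y z
      simp only [mem_steppedBox, mem_latticeBox, Finset.mem_filter, Finset.mem_range]
      constructor
      · intro h
        by_cases h1 : ¬ (a ≤ x ∧ x < a + k) ∧ p ≤ y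
        · exact Or.inr ⟨x, by omega, by omega⟩
        · exact Or.inl (by omega)
      · rintro (h | ⟨i, hi, h⟩) <;> omega
    · intro i hi x y z
      simp only [mem_steppedBox, mem_latticeBox, Finset.mem_filter, Finset.mem_range] at hi ⊢
      omega
  · intro T hT
    refine ⟨(), Finset.image_subset_iff.2 fun x hx => ?_⟩
    simp only [Finset.mem_filter, Finset.mem_range] at hx
    simpa using (hT.outer_brick ha hm hqp hx.1 hx.2).2
  · intros
    rfl

end Outer

/-! ### Peeling the protruding middle block -/

section Gap

variable {k m a p q : ℕ}

/-- Beyond level `p` the region is exactly `k` columns wide, so a brick of width `k` there must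
start at `a`. -/
theorem IsTilingOf.gap_brick (hk : 0 < k) (hpq : p < q) {T : Finset (Finset (ℕ × ℕ × ℕ))}
    (ha : a + k ≤ m) (hT : IsTilingOf k (steppedBox k m a p q) T) {x z : ℕ}
    (hx : a ≤ x ∧ x < a + k) (hz : z < k) :
    (k ≤ q ∧ latticeBox (a, q - k, z) (k, k, 1) ∈ T) ∨
      latticeBox (a, q - 1, 0) (k, 1, k) ∈ T ∨
      k ≤ q ∧ latticeBox (x, q - k, 0) (1, k, k) ∈ T := by
  obtain ⟨x₀, y₀, hB, h⟩ | ⟨x₀, hB, h⟩ | ⟨y₀, hB, h⟩ :=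
    hT.exists_brick_steppedBox hk (x := x) (y := q - 1) (z := z)
      (mem_steppedBox.2 (by omega))
  · have h1 := mem_steppedBox.1 (hT.box_subset hB x₀ (q - 1) z (by omega))
    have h2 := mem_steppedBox.1 (hT.box_subset hB (x₀ + k - 1) (q - 1) z (by omega))
    have h3 := mem_steppedBox.1 (hT.box_subset hB x (y₀ + k - 1) z (by omega))
    obtain rfl : x₀ = a := by omega
    obtain rfl : y₀ = q - k := by omega
    exact Or.inl ⟨by omega, hB⟩
  · have h1 := mem_steppedBox.1 (hT.box_subset hB x₀ (q - 1) z (by omega))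
    have h2 := mem_steppedBox.1 (hT.box_subset hB (x₀ + k - 1) (q - 1) z (by omega))
    obtain rfl : x₀ = a := by omega
    exact Or.inr (Or.inl hB)
  · have h3 := mem_steppedBox.1 (hT.box_subset hB x (y₀ + k - 1) z (by omega))
    obtain rfl : y₀ = q - k := by omega
    exact Or.inr (Or.inr ⟨by omega, hB⟩)

/-- The protruding end of the columns over `[a, a + k)` consists of parallel bricks. -/
theorem IsTilingOf.gap_cases (hk : 1 < k) (hpq : p < q) {T : Finset (Finset (ℕ × ℕ × ℕ))}
    (ha : a + k ≤ m) (hT : IsTilingOf k (steppedBox k m a p q) T) :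
    latticeBox (a, q - 1, 0) (k, 1, k) ∈ T ∨
      k ≤ q ∧ ((∀ i < k, latticeBox (a + i, q - k, 0) (1, k, k) ∈ T) ∨
        ∀ z < k, latticeBox (a, q - k, z) (k, k, 1) ∈ T) := by
  have hk0 : 0 < k := by omega
  by_cases hA : latticeBox (a, q - 1, 0) (k, 1, k) ∈ T
  · exact Or.inl hA
  refine Or.inr ?_
  -- The brick at the corner column `a`, height `0`, fixes the type: a horizontal brick at height
  -- `0` and a brick along column `a` would overlap.
  obtain ⟨hq, h⟩ | h | ⟨hq, h⟩ := hT.gap_brick hk0 hpq ha (x := a) (z := 0) (by omega) hk0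
  · refine ⟨hq, Or.inr fun z hz => ?_⟩
    obtain h' | h' | h' := hT.gap_brick hk0 hpq ha (x := a) (z := z) (by omega) hz
    · exact h'.2
    · exact absurd h' hA
    · have := hT.box_injective h h'.2 a (q - k) 0 (by omega) (by omega)
      omega
  · exact absurd h hA
  · refine ⟨hq, Or.inl fun i hi => ?_⟩
    obtain h' | h' | h' := hT.gap_brick hk0 hpq ha (x := a + i) (z := 0) (by omega) hk0
    · have := hT.box_injective h h'.2 a (q - k) 0 (by omega) (by omega)
      omega
    · exact absurd h' hA
    · exact h'.2

theorem card_tilings_containing_singleton (hk : 0 < k) (ha : a + k ≤ m) :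
    ((tilings k (steppedBox k m a p (q + 1))).filter
      fun T => {latticeBox (a, q, 0) (k, 1, k)} ⊆ T).card =
      (tilings k (steppedBox k m a p q)).card := by
  refine card_tilings_containing hk ?_ (by simp) ?_ ?_
  · intro B hB
    exact ⟨_, Or.inr (Or.inl (Finset.mem_singleton.1 hB))⟩
  · rintro ⟨x, y, z⟩
    simp only [Finset.mem_singleton, exists_eq_left, mem_steppedBox, mem_latticeBox]
    omega
  · rintro B hB ⟨x, y, z⟩
    rw [Finset.mem_singleton] at hB
    subst hB
    rw [mem_steppedBox, mem_latticeBox]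
    omega

theorem card_tilings_containing_gap_bars (hk : 0 < k) (ha : a + k ≤ m) :
    ((tilings k (steppedBox k m a p (q + k))).filter
      fun T => (Finset.range k).image (fun i => latticeBox (a + i, q, 0) (1, k, k)) ⊆ T).card =
      (tilings k (steppedBox k m a p q)).card := by
  refine card_tilings_containing_image hk (fun i => ⟨_, Or.inr (Or.inr rfl)⟩) ?_ ?_ ?_
  · intro i j x y z
    rw [mem_latticeBox, mem_latticeBox]
    omega
  · intro x y z
    simp only [mem_steppedBox, mem_latticeBox, Finset.mem_range]
    constructor
    · intro h
      by_cases h1 : (a ≤ x ∧ x < a + k) ∧ q ≤ y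
      · exact Or.inr ⟨x - a, by omega, by omega⟩
      · exact Or.inl (by omega)
    · rintro (h | ⟨i, hi, h⟩) <;> omega
  · intro i hi x y z
    simp only [mem_steppedBox, mem_latticeBox, Finset.mem_range] at hi ⊢
    omega

theorem card_tilings_containing_gap_slabs (hk : 0 < k) (ha : a + k ≤ m) :
    ((tilings k (steppedBox k m a p (q + k))).filter
      fun T => (Finset.range k).image (fun z => latticeBox (a, q, z) (k, k, 1)) ⊆ T).card =
      (tilings k (steppedBox k m a p q)).card := by
  refine card_tilings_containing_image hk (fun i => ⟨_, Or.inl rfl⟩) ?_ ?_ ?_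
  · intro i j x y z
    rw [mem_latticeBox, mem_latticeBox]
    omega
  · intro x y z
    simp only [mem_steppedBox, mem_latticeBox, Finset.mem_range]
    constructor
    · intro h
      by_cases h1 : (a ≤ x ∧ x < a + k) ∧ q ≤ y
      · exact Or.inr ⟨z, by omega, by omega⟩
      · exact Or.inl (by omega)
    · rintro (h | ⟨i, hi, h⟩) <;> omega
  · intro i hi x y z
    simp only [mem_steppedBox, mem_latticeBox, Finset.mem_range] at hi ⊢
    omega

theorem card_tilings_gap_of_lt (hk : 1 < k) (hpq : p ≤ q) (hqk : q + 1 < k) (ha : a + k ≤ m) :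
    (tilings k (steppedBox k m a p (q + 1))).card =
      (tilings k (steppedBox k m a p q)).card := by
  rw [← card_tilings_containing_singleton (q := q) (by omega) ha,
    card_tilings_eq_sum (ι := Unit) (fun _ => {latticeBox (a, q, 0) (k, 1, k)}),
    Fintype.sum_unique]
  · intro T hT
    refine ⟨(), Finset.singleton_subset_iff.2 ?_⟩
    exact (hT.gap_cases hk (by omega) ha).resolve_right (by omega)
  · intros
    rfl

theorem card_tilings_gap (hk : 1 < k) (hpq : p < q + k) (ha : a + k ≤ m) :
    (tilings k (steppedBox k m a p (q + k))).card =
      (tilings k (steppedBox k m a p (q + k - 1))).card +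
        2 * (tilings k (steppedBox k m a p q)).card := by
  have hk0 : 0 < k := by omega
  have hA := card_tilings_containing_singleton (q := q + k - 1) (p := p) hk0 ha
  rw [show q + k - 1 + 1 = q + k by omega] at hA
  have hB := card_tilings_containing_gap_bars (p := p) (q := q) hk0 ha
  have hC := card_tilings_containing_gap_slabs (p := p) (q := q) hk0 ha
  rw [two_mul, ← add_assoc]
  rw [card_tilings_eq_sum (ι := Fin 3) ![{latticeBox (a, q + k - 1, 0) (k, 1, k)},
    (Finset.range k).image (fun i => latticeBox (a + i, q, 0) (1, k, k)),
    (Finset.range k).image (fun z => latticeBox (a, q, z) (k, k, 1))], Fin.sum_univ_three]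
  · exact congrArg₂ _ (congrArg₂ _ hA hB) hC
  · intro T hT
    have h := hT.gap_cases hk hpq ha
    rw [Nat.add_sub_cancel] at h
    obtain h | ⟨-, h | h⟩ := h
    · exact ⟨0, Finset.singleton_subset_iff.2 h⟩
    · exact ⟨1, Finset.image_subset_iff.2 fun i hi => h i (Finset.mem_range.1 hi)⟩
    · exact ⟨2, Finset.image_subset_iff.2 fun i hi => h i (Finset.mem_range.1 hi)⟩
  · intro T hT
    have h01 : ¬ (latticeBox (a, q + k - 1, 0) (k, 1, k) ∈ T ∧
        latticeBox (a + 0, q, 0) (1, k, k) ∈ T) := fun h => by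
      have := hT.box_injective h.1 h.2 a (q + k - 1) 0 (by omega) (by omega)
      omega
    have h02 : ¬ (latticeBox (a, q + k - 1, 0) (k, 1, k) ∈ T ∧
        latticeBox (a, q, 0) (k, k, 1) ∈ T) := fun h => by
      have := hT.box_injective h.1 h.2 a (q + k - 1) 0 (by omega) (by omega)
      omega
    have h12 : ¬ (latticeBox (a + 0, q, 0) (1, k, k) ∈ T ∧
        latticeBox (a, q, 0) (k, k, 1) ∈ T) := fun h => by
      have := hT.box_injective h.1 h.2 a q 0 (by omega) (by omega)
      omega
    have hr := Finset.mem_range.2 hk0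
    have e0 : ({latticeBox (a, q + k - 1, 0) (k, 1, k)} : Finset _) ⊆ T →
      latticeBox (a, q + k - 1, 0) (k, 1, k) ∈ T := Finset.singleton_subset_iff.1
    have e1 : (Finset.range k).image (fun i => latticeBox (a + i, q, 0) (1, k, k)) ⊆ T →
      latticeBox (a + 0, q, 0) (1, k, k) ∈ T := fun h => Finset.image_subset_iff.1 h 0 hr
    have e2 : (Finset.range k).image (fun z => latticeBox (a, q, z) (k, k, 1)) ⊆ T →
      latticeBox (a, q, 0) (k, k, 1) ∈ T := fun h => Finset.image_subset_iff.1 h 0 hr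
    intro i j hi hj
    fin_cases i <;> fin_cases j
    · rfl
    · exact absurd ⟨e0 hi, e1 hj⟩ h01
    · exact absurd ⟨e0 hi, e2 hj⟩ h02
    · exact absurd ⟨e0 hj, e1 hi⟩ h01
    · rfl
    · exact absurd ⟨e1 hi, e2 hj⟩ h12
    · exact absurd ⟨e0 hj, e2 hi⟩ h02
    · exact absurd ⟨e1 hj, e2 hi⟩ h12
    · rfl

end Gap

/-! ### The end of the full cuboid -/

section Full

variable {k m n : ℕ}

theorem IsTilingOf.top_brick (hk : 0 < k) (hn : 0 < n) {T : Finset (Finset (ℕ × ℕ × ℕ))}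
    (hT : IsTilingOf k (cuboid m n k) T) {x z : ℕ} (hx : x < m) (hz : z < k) :
    (∃ a, a + k ≤ m ∧ (a ≤ x ∧ x < a + k) ∧
      (k ≤ n ∧ latticeBox (a, n - k, z) (k, k, 1) ∈ T ∨
        latticeBox (a, n - 1, 0) (k, 1, k) ∈ T)) ∨
      k ≤ n ∧ latticeBox (x, n - k, 0) (1, k, k) ∈ T := by
  obtain ⟨x₀, y₀, hB, h⟩ | ⟨x₀, hB, h⟩ | ⟨y₀, hB, h⟩ :=
    hT.exists_brick hk (fun _ _ _ h => (mem_cuboid.1 h).2.2) (x := x) (y := n - 1) (z := z)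
      (mem_cuboid.2 (by omega))
  · have h1 := mem_cuboid.1 (hT.box_subset hB (x₀ + k - 1) (y₀ + k - 1) z (by omega))
    obtain rfl : y₀ = n - k := by omega
    exact Or.inl ⟨x₀, by omega, by omega, Or.inl ⟨by omega, hB⟩⟩
  · have h1 := mem_cuboid.1 (hT.box_subset hB (x₀ + k - 1) (n - 1) z (by omega))
    exact Or.inl ⟨x₀, by omega, by omega, Or.inr hB⟩
  · have h1 := mem_cuboid.1 (hT.box_subset hB x (y₀ + k - 1) z (by omega))
    obtain rfl : y₀ = n - k := by omega
    exact Or.inr ⟨by omega, hB⟩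

/-- Only bricks across fit. Those covering the first and last columns both contain column `k - 1`,
so they coincide, yet `k < m`. -/
theorem card_tilings_cuboid_of_lt (hkm : k < m) (hm : m < 2 * k) (hn : 0 < n) (hnk : n < k) :
    (tilings k (cuboid m n k)).card = 0 := by
  rw [Finset.card_eq_zero, Finset.eq_empty_iff_forall_notMem]
  intro T hT
  rw [mem_tilings] at hT
  have hk : 0 < k := by omega
  obtain ⟨a, h1, h2, h3 | hB⟩ | h := hT.top_brick hk hn (x := 0) (z := 0) (by omega) hk
  · omega
  · obtain ⟨b, h4, h5, h6 | hC⟩ | h := hT.top_brick hk hn (x := m - 1) (z := 0) (by omega) hk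
    · omega
    · have := hT.box_injective hB hC (k - 1) (n - 1) 0 (by omega) (by omega)
      omega
    · omega
  · omega

/-- At the end of the cuboid there are only bricks along it, or a packet of `k` horizontal
bricks, or a brick across it. -/
theorem IsTilingOf.top_cases (hkm : k < m) (hm : m < 2 * k) (hn : 0 < n)
    {T : Finset (Finset (ℕ × ℕ × ℕ))} (hT : IsTilingOf k (cuboid m n k) T) :
    (k ≤ n ∧ ∀ x < m, latticeBox (x, n - k, 0) (1, k, k) ∈ T) ∨
      ∃ a, a + k ≤ m ∧ ((k ≤ n ∧ ∀ z < k, latticeBox (a, n - k, z) (k, k, 1) ∈ T) ∨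
        latticeBox (a, n - 1, 0) (k, 1, k) ∈ T) := by
  have hk : 1 < k := by omega
  have hk0 : 0 < k := by omega
  obtain ⟨a, ha, hak, ⟨hkn, hB⟩ | hB⟩ | ⟨hkn, hB⟩ :=
    hT.top_brick hk0 hn (x := k - 1) (z := 0) (by omega) hk0
  · have hout : ∀ x < m, ¬ (a ≤ x ∧ x < a + k) → latticeBox (x, n - k, 0) (1, k, k) ∈ T := by
      intro x hx hxa
      obtain ⟨b, hb, hbx, ⟨-, hC⟩ | hC⟩ | h := hT.top_brick hk0 hn hx hk0
      · have := hT.box_injective hB hC (k - 1) (n - 1) 0 (by omega) (by omega)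
        omega
      · have := hT.box_injective hB hC (k - 1) (n - 1) 0 (by omega) (by omega)
        omega
      · exact h.2
    refine Or.inr ⟨a, ha, Or.inl ⟨hkn, fun z hz => ?_⟩⟩
    obtain ⟨b, hb, hbx, ⟨-, hC⟩ | hC⟩ | ⟨-, hC⟩ :=
      hT.top_brick hk0 hn (x := k - 1) (z := z) (by omega) hz
    -- A horizontal brick shifted relative to the one at height `0` would enter an outer column,
    -- already filled to full height by a brick along it.
    · obtain h | rfl | h := lt_trichotomy a b
      · have h1 := hout (b + k - 1) (by omega) (by omega)
        have := hT.box_injective h1 hC (b + k - 1) (n - 1) z (by omega) (by omega)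
        omega
      · exact hC
      · have h1 := hout b (by omega) (by omega)
        have := hT.box_injective h1 hC b (n - 1) z (by omega) (by omega)
        omega
    · have := hT.box_injective hB hC (k - 1) (n - 1) 0 (by omega) (by omega)
      omega
    · have := hT.box_injective hB hC (k - 1) (n - 1) 0 (by omega) (by omega)
      omega
  · exact Or.inr ⟨a, ha, Or.inr hB⟩
  · refine Or.inl ⟨hkn, fun x hx => ?_⟩
    obtain ⟨b, hb, hbx, ⟨-, hC⟩ | hC⟩ | h := hT.top_brick hk0 hn hx hk0
    · have := hT.box_injective hB hC (k - 1) (n - 1) 0 (by omega) (by omega)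
      omega
    · have := hT.box_injective hB hC (k - 1) (n - 1) 0 (by omega) (by omega)
      omega
    · exact h.2

theorem card_tilings_containing_bars (hk : 0 < k) :
    ((tilings k (cuboid m (n + k) k)).filter
      fun T => (Finset.range m).image (fun i => latticeBox (i, n, 0) (1, k, k)) ⊆ T).card =
      (tilings k (cuboid m n k)).card := by
  refine card_tilings_containing_image hk (fun i => ⟨_, Or.inr (Or.inr rfl)⟩) ?_ ?_ ?_
  · intro i j x y z
    rw [mem_latticeBox, mem_latticeBox]
    omega
  · intro x y z
    simp only [mem_cuboid, mem_latticeBox, Finset.mem_range]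
    constructor
    · intro h
      by_cases h1 : n ≤ y
      · exact Or.inr ⟨x, by omega, by omega⟩
      · exact Or.inl (by omega)
    · rintro (h | ⟨i, hi, h⟩) <;> omega
  · intro i hi x y z
    simp only [mem_cuboid, mem_latticeBox, Finset.mem_range] at hi ⊢
    omega

theorem card_tilings_cuboid (hkm : k < m) (hm : m < 2 * k) :
    (tilings k (cuboid m (n + k) k)).card =
      (tilings k (cuboid m n k)).card +
        (∑ _a : Fin (m - k + 1), (tilings k (cuboid m n k)).card +
          ∑ a : Fin (m - k + 1), (tilings k (steppedBox k m a n (n + k - 1))).card) := by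
  have hk : 1 < k := by omega
  have hk0 : 0 < k := by omega
  have hslab : ∀ a : Fin (m - k + 1), ((tilings k (cuboid m (n + k) k)).filter
      fun T => (Finset.range k).image (fun z => latticeBox (a, n, z) (k, k, 1)) ⊆ T).card =
      (tilings k (cuboid m n k)).card := fun a => by
    -- Without the packet the outer columns protrude by `k`; their forced ends leave a cuboid of
    -- length `n`.
    rw [← steppedBox_self k m a (n + k), card_tilings_containing_gap_slabs hk0 (by omega),
      card_tilings_outer (by omega) hm (by omega), steppedBox_self]
  have hcross : ∀ a : Fin (m - k + 1), ((tilings k (cuboid m (n + k) k)).filter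
      fun T => {latticeBox (a, n + k - 1, 0) (k, 1, k)} ⊆ T).card =
      (tilings k (steppedBox k m a n (n + k - 1))).card := fun a => by
    have h := card_tilings_containing_singleton (k := k) (m := m) (a := a) (p := n + k)
      (q := n + k - 1) hk0
    rw [show n + k - 1 + 1 = n + k by omega, steppedBox_self] at h
    rw [h (by omega), card_tilings_outer (by omega) hm (by omega)]
  rw [card_tilings_eq_sum (ι := Unit ⊕ (Fin (m - k + 1) ⊕ Fin (m - k + 1)))
    (Sum.elim (fun _ => (Finset.range m).image (fun i => latticeBox (i, n, 0) (1, k, k)))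
      (Sum.elim (fun a => (Finset.range k).image (fun z => latticeBox (a, n, z) (k, k, 1)))
        (fun a => {latticeBox (a, n + k - 1, 0) (k, 1, k)}))),
    Fintype.sum_sum_type, Fintype.sum_sum_type, Fintype.sum_unique]
  · exact congrArg₂ _ (card_tilings_containing_bars hk0)
      (congrArg₂ _ (Finset.sum_congr rfl fun a _ => hslab a)
        (Finset.sum_congr rfl fun a _ => hcross a))
  · intro T hT
    have h := hT.top_cases hkm hm (by omega)
    rw [Nat.add_sub_cancel] at h
    obtain ⟨-, h⟩ | ⟨a, ha, ⟨-, h⟩ | h⟩ := h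
    · exact ⟨Sum.inl (), Finset.image_subset_iff.2 fun i hi => h i (Finset.mem_range.1 hi)⟩
    · exact ⟨Sum.inr (Sum.inl ⟨a, by omega⟩),
        Finset.image_subset_iff.2 fun i hi => h i (Finset.mem_range.1 hi)⟩
    · exact ⟨Sum.inr (Sum.inr ⟨a, by omega⟩), Finset.singleton_subset_iff.2 h⟩
  · intro T hT
    have e0 : (Finset.range m).image (fun i => latticeBox (i, n, 0) (1, k, k)) ⊆ T →
        latticeBox (k - 1, n, 0) (1, k, k) ∈ T := fun h =>
      Finset.image_subset_iff.1 h (k - 1) (Finset.mem_range.2 (by omega))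
    have e1 : ∀ a : Fin (m - k + 1),
        (Finset.range k).image (fun z => latticeBox (a, n, z) (k, k, 1)) ⊆ T →
        latticeBox (a, n, 0) (k, k, 1) ∈ T := fun a h =>
      Finset.image_subset_iff.1 h 0 (Finset.mem_range.2 hk0)
    have e2 : ∀ a : Fin (m - k + 1),
        ({latticeBox (a, n + k - 1, 0) (k, 1, k)} : Finset (Finset (ℕ × ℕ × ℕ))) ⊆ T →
        latticeBox (a, n + k - 1, 0) (k, 1, k) ∈ T := fun a h => Finset.singleton_subset_iff.1 h
    -- Each configuration has a brick covering the cell `(k - 1, n + k - 1, 0)`, so two different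
    -- ones cannot occur together.
    have key : ∀ {a b c u v w a' b' c' u' v' w' : ℕ},
        latticeBox (a, b, c) (u, v, w) ∈ T → latticeBox (a', b', c') (u', v', w') ∈ T → _ :=
      fun h h' => hT.box_injective h h' (k - 1) (n + k - 1) 0
    rintro (⟨⟩ | a | a) (⟨⟩ | b | b) hi hj
    · rfl
    · have := key (e0 hi) (e1 b hj) (by omega) (by omega)
      omega
    · have := key (e0 hi) (e2 b hj) (by omega) (by omega)
      omega
    · have := key (e1 a hi) (e0 hj) (by omega) (by omega)
      omega
    · have := key (e1 a hi) (e1 b hj) (by omega) (by omega)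
      obtain rfl : a = b := by omega
      rfl
    · have := key (e1 a hi) (e2 b hj) (by omega) (by omega)
      omega
    · have := key (e2 a hi) (e0 hj) (by omega) (by omega)
      omega
    · have := key (e2 a hi) (e1 b hj) (by omega) (by omega)
      omega
    · have := key (e2 a hi) (e2 b hj) (by omega) (by omega)
      obtain rfl : a = b := by omega
      rfl

end Full

theorem card_tilings_empty {k : ℕ} (hk : 0 < k) : (tilings k ∅).card = 1 := by
  rw [Finset.card_eq_one]
  refine ⟨∅, ?_⟩
  ext T
  rw [mem_tilings, Finset.mem_singleton]
  constructor
  · intro hT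
    refine Finset.eq_empty_iff_forall_notMem.2 fun B hB => ?_
    obtain ⟨c, hc⟩ := (hT.1 B hB).nonempty hk
    exact absurd (hT.subset hB hc) (Finset.notMem_empty c)
  · rintro rfl
    exact ⟨by simp, by simp, by simp⟩

/-! ### Generating functions -/

/-- The generating function of the tilings of the stepped boxes with a step of length `j`. -/
noncomputable def steppedSeries (k m a j : ℕ) : PowerSeries ℚ :=
  PowerSeries.mk fun p => ((tilings k (steppedBox k m a p (p + j))).card : ℚ)

theorem steppedSeries_zero (k m a : ℕ) :
    steppedSeries k m a 0 = PowerSeries.mk fun n => (numBrickTilings k m n : ℚ) := by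
  ext n
  rw [steppedSeries, PowerSeries.coeff_mk, PowerSeries.coeff_mk, Nat.add_zero, steppedBox_self,
    numBrickTilings_eq_card]

theorem steppedSeries_succ {k m a j : ℕ} (hkm : k < m) (hm : m < 2 * k) (ha : a + k ≤ m)
    (hj : j + 1 < k) :
    (1 - 2 * (PowerSeries.X : PowerSeries ℚ) ^ k) * steppedSeries k m a (j + 1) =
      steppedSeries k m a j := by
  rw [sub_mul, one_mul, sub_eq_iff_eq_add, mul_assoc]
  ext p
  rw [map_add, two_mul, map_add, PowerSeries.coeff_X_pow_mul', steppedSeries, steppedSeries]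
  simp only [PowerSeries.coeff_mk]
  have hk : 1 < k := by omega
  split_ifs with hp
  · obtain ⟨p, rfl⟩ := Nat.exists_eq_add_of_le' hp
    rw [Nat.add_sub_cancel]
    have h1 := card_tilings_gap (p := p + k) (q := p + (j + 1)) hk (by omega) ha
    rw [card_tilings_outer (q := p + (j + 1)) ha hm (by omega)] at h1
    rw [show p + k + (j + 1) = p + (j + 1) + k by omega, h1,
      show p + (j + 1) + k - 1 = p + k + j by omega]
    push_cast
    ring
  · rw [add_zero, add_zero, Nat.cast_inj, ← add_assoc]
    by_cases h : p + j + 1 < k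
    · exact card_tilings_gap_of_lt hk (by omega) h ha
    · obtain ⟨q, hq⟩ := Nat.exists_eq_add_of_le' (not_lt.1 h)
      -- Peeling `k` parallel bricks leaves outer columns that protrude but are shorter than a
      -- brick, so both such terms vanish.
      rw [hq, card_tilings_gap hk (by omega) ha,
        card_tilings_outer_of_lt (q := q) ha hkm hm (by omega) (by omega)]
      rw [show q + k - 1 = p + j by omega, mul_zero, add_zero]

theorem steppedSeries_eq {k m a : ℕ} (hkm : k < m) (hm : m < 2 * k) (ha : a + k ≤ m) {j : ℕ}
    (hj : j < k) :
    (1 - 2 * (PowerSeries.X : PowerSeries ℚ) ^ k) ^ j * steppedSeries k m a j =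
      PowerSeries.mk fun n => (numBrickTilings k m n : ℚ) := by
  induction j with
  | zero => rw [pow_zero, one_mul, steppedSeries_zero]
  | succ j ih => rw [pow_succ, mul_assoc, steppedSeries_succ hkm hm ha hj, ih (by omega)]

theorem mk_numBrickTilings_eq {k m : ℕ} (hkm : k < m) (hm : m < 2 * k) :
    (PowerSeries.mk fun n => (numBrickTilings k m n : ℚ)) =
      1 + (PowerSeries.X : PowerSeries ℚ) ^ k *
        ((PowerSeries.mk fun n => (numBrickTilings k m n : ℚ)) +
          (∑ _a : Fin (m - k + 1), (PowerSeries.mk fun n => (numBrickTilings k m n : ℚ)) +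
            ∑ a : Fin (m - k + 1), steppedSeries k m a (k - 1))) := by
  have hk : 0 < k := by omega
  ext n
  rw [map_add, PowerSeries.coeff_X_pow_mul', PowerSeries.coeff_one, PowerSeries.coeff_mk,
    numBrickTilings_eq_card]
  split_ifs with h0 hn hn
  · omega
  · rw [h0, show cuboid m 0 k = ∅ from by ext ⟨x, y, z⟩; simp [mem_cuboid],
      card_tilings_empty hk, Nat.cast_one, add_zero]
  · obtain ⟨n, rfl⟩ := Nat.exists_eq_add_of_le' hn
    rw [Nat.add_sub_cancel, card_tilings_cuboid hkm hm, zero_add]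
    simp only [map_add, map_sum, steppedSeries, PowerSeries.coeff_mk, numBrickTilings_eq_card]
    push_cast
    simp only [Nat.add_sub_assoc hk]
  · rw [card_tilings_cuboid_of_lt hkm hm (by omega) (by omega), Nat.cast_zero, add_zero]

theorem mainTheorem3 (k m : ℕ) (hkm : k < m) (hmk : m < 2 * k) :
    (PowerSeries.mk fun n : ℕ => (numBrickTilings k m n : ℚ)) =
      (1 - 2 * (PowerSeries.X : PowerSeries ℚ) ^ k) ^ (k - 1) *
        ((1 - 2 * (PowerSeries.X : PowerSeries ℚ) ^ k) ^ (k - 1) *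
            (1 - PowerSeries.C ((m : ℚ) - (k : ℚ) + 2) * (PowerSeries.X : PowerSeries ℚ) ^ k) -
          PowerSeries.C ((m : ℚ) - (k : ℚ) + 1) * (PowerSeries.X : PowerSeries ℚ) ^ k)⁻¹ := by
  have hk : k ≠ 0 := by omega
  -- The denominator has constant term 1, as `k ≠ 0`.
  rw [PowerSeries.eq_mul_inv_iff_mul_eq (by simp [hk])]
  have h := mk_numBrickTilings_eq hkm hmk
  have hs : (1 - 2 * (PowerSeries.X : PowerSeries ℚ) ^ k) ^ (k - 1) *
      ∑ a : Fin (m - k + 1), steppedSeries k m a (k - 1) =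
      ∑ _a : Fin (m - k + 1), PowerSeries.mk fun n => (numBrickTilings k m n : ℚ) := by
    rw [Finset.mul_sum]
    exact Finset.sum_congr rfl fun a _ => steppedSeries_eq hkm hmk (by omega) (by omega)
  rw [Finset.sum_const, Finset.card_univ, Fintype.card_fin, nsmul_eq_mul] at h hs
  have hd : ((m - k + 1 : ℕ) : PowerSeries ℚ) = PowerSeries.C ((m : ℚ) - (k : ℚ) + 1) := by
    rw [← map_natCast (PowerSeries.C (R := ℚ)), Nat.cast_add, Nat.cast_sub hkm.le, Nat.cast_one]
  have hd' : PowerSeries.C ((m : ℚ) - (k : ℚ) + 2) =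
      PowerSeries.C ((m : ℚ) - (k : ℚ) + 1) + 1 := by
    rw [← map_one (PowerSeries.C (R := ℚ)), ← map_add]
    congr 1
    ring
  rw [hd] at h hs
  rw [hd']
  -- Scaling the recursion `h` by this power lets `hs` eliminate the stepped series.
  linear_combination (1 - 2 * (PowerSeries.X : PowerSeries ℚ) ^ k) ^ (k - 1) * h +
    (PowerSeries.X : PowerSeries ℚ) ^ k * hs
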